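/- Let $n\ge 0$ be an integer, let $\mathbb F_q$ be a finite field with $q$ elements, and fix a nontrivial homomorphism $\theta:\mathbb F_q^+\to\mathbb C^\times$. Put $[[n]]=\{(i,j):1\le i<j\le n\}$. A *poset* on $[n]=\{1,\dots,n\}$ is a subset $\mathcal P\subset[[n]]$ such that $(i,j),(j,k)\in\mathcal P$ implies $(i,k)\in\mathcal P$; write $\mathcal P\vartriangleleft[[n]]$ if $(i,l)\notin\mathcal P$ implies $(j,k)\notin\mathcal P$ for all $1\le i\le j<k\le l\le n$. Let $\mathfrak n_{\mathcal P}$ be the algebra of $n\times n$ matrices over $\mathbb F_q$ whose nonzero entries lie at positions in $\mathcal P$, let $U_{\mathcal P}=1+\mathfrak n_{\mathcal P}$, and write $U_n=U_{[[n]]}$, $\mathfrak n_n=\mathfrak n_{[[n]]}$. For a linear functional $\lambda\in\mathfrak n_{\mathcal P}^*$ let $\lambda_{ij}=\lambda(e_{ij})$ if $(i,j)\in\mathcal P$ and $\lambda_{ij}=0$ otherwise, and $\mathrm{supp}(\lambda)=\{(i,j)\in\mathcal P:\lambda_{ij}\ne0\}$. Let $\mathscr S_{\mathcal P}^*$ be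 the set of $\lambda\in\mathfrak n_{\mathcal P}^*$ whose support has at most one position in each row and in each column, and $\mathscr S_n^*=\mathscr S_{[[n]]}^*$. The group $U_{\mathcal P}$ acts on $\mathfrak n_{\mathcal P}^*$ on the left and on the right by $g\lambda(X)=\lambda(g^{-1}X)$ and $\lambda g(X)=\lambda(Xg^{-1})$. The supercharacter of $U_{\mathcal P}$ indexed by $\lambda\in\mathfrak n_{\mathcal P}^*$ is $$\chi_{\mathcal P}^\lambda(g)=\frac{|U_{\mathcal P}\lambda|}{|U_{\mathcal P}\lambda U_{\mathcal P}|}\sum_{\nu\in U_{\mathcal P}\lambda U_{\mathcal P}}\theta(\nu(g-1)),\qquad g\in U_{\mathcal P},$$ and $\chi^\lambda=\chi^\lambda_{[[n]]}$. For $\lambda\in\mathfrak n_{\mathcal P}^*$ and $\mathcal Q\in\{\mathcal P,[[n]]\}$ define $$\mathrm{coadj}^{\mathrm L}_{\mathcal Q}(\lambda)=\{(j,k)\in\mathcal P:\exists\,(i,k)\in\mathrm{supp}(\lambda)\text{ with }(i,j)\in\mathcal Q\},$$ $$\mathrm{coadj}^{\mathrm R}_{\mathcal Q}(\lambda)=\{(i,j)\in\mathcal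 P:\exists\,(i,k)\in\mathrm{supp}(\lambda)\text{ with }(j,k)\in\mathcal Q\},$$ $\mathrm{coadj}_{\mathcal Q}(\lambda)=\mathrm{coadj}^{\mathrm L}_{\mathcal Q}(\lambda)\cup\mathrm{coadj}^{\mathrm R}_{\mathcal Q}(\lambda)$, and $\mathrm{coaux}^{\mathrm L}_{\mathcal P}(\lambda)=\mathrm{coadj}^{\mathrm L}_{[[n]]}(\lambda)\setminus\mathrm{coadj}^{\mathrm L}_{\mathcal P}(\lambda)$, and similarly $\mathrm{coaux}^{\mathrm R}_{\mathcal P}(\lambda)$ and $\mathrm{coaux}_{\mathcal P}(\lambda)$ (with superscript $\mathrm R$, respectively none, throughout). For $\mathcal P\vartriangleleft[[n]]$, $\lambda\in\mathscr S_{\mathcal P}^*$ and $\alpha,\beta\in\mathfrak n_{\mathcal P}^*$ let $\alpha*_\lambda\beta\in\mathfrak n_{\mathcal P}^*$ be the functional with $$(\alpha*_\lambda\beta)_{jk}=\alpha_{jk}+\beta_{jk}+\sum_{\substack{i<j<k<l\\(i,l)\in\mathrm{supp}(\lambda)}}\alpha_{jl}\,\beta_{ik}\,(\lambda_{il})^{-1},\qquad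 (j,k)\in\mathcal P.$$ If $\mathrm{supp}(\eta)\subset\mathrm{coaux}_{\mathcal P}(\lambda)$, write $\eta=\eta_{\mathrm L}+\eta_{\mathrm R\setminus\mathrm L}$ with $\mathrm{supp}(\eta_{\mathrm L})\subset\mathrm{coaux}^{\mathrm L}_{\mathcal P}(\lambda)$ and $\mathrm{supp}(\eta_{\mathrm R\setminus\mathrm L})\subset\mathrm{coaux}^{\mathrm R}_{\mathcal P}(\lambda)\setminus\mathrm{coaux}^{\mathrm L}_{\mathcal P}(\lambda)$ (this is possible in exactly one way), and let $\chi_{\mathcal P}^{(\lambda,\eta)}$ be the supercharacter of $U_{\mathcal P}$ indexed by $\lambda+\eta_{\mathrm L}*_\lambda\eta_{\mathrm R\setminus\mathrm L}$. **Corollary.** Let $\mathcal P$ be a poset on $[n]$ with $\mathcal P\vartriangleleft[[n]]$, let $\lambda\in\mathscr S_n^*$, and let $\mu$ be the restriction of $\lambda$ to $\mathfrak n_{\mathcal P}$. Then $\mu\in\mathscr S_{\mathcal P}^*$, and the restriction of $\chi^\lambda$ to $U_{\mathcal P}$ is $$\mathrm{Res}^{U_n}_{U_{\mathcal P}}(\chi^\lambda)=q^c\sum_{\eta}\chi_{\mathcal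 P}^{(\mu,\eta)},\qquad c=|\mathrm{coadj}^{\mathrm L}_{[[n]]}(\lambda)|-|\mathrm{coadj}^{\mathrm L}_{\mathcal P}(\mu)|-|\mathrm{coaux}_{\mathcal P}(\mu)|,$$ where the sum is over all $\eta\in\mathfrak n_{\mathcal P}^*$ with $\mathrm{supp}(\eta)\subset\mathrm{coaux}_{\mathcal P}(\mu)$. (Here $\mathrm{coadj}^{\mathrm L}_{[[n]]}(\lambda)$ is formed for $\lambda\in\mathfrak n_n^*$, that is, with $[[n]]$ in the role of $\mathcal P$.) -/

import Mathlib

namespace PatternGroup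

/-- A poset on `[n]`: a set of positions strictly above the diagonal which is transitive.
Rows and columns are indexed by `Fin n`. -/
structure PosetOn (n : ℕ) where
  carrier : Set (Fin n × Fin n)
  lt_of_mem : ∀ {i j : Fin n}, (i, j) ∈ carrier → i < j
  trans_mem : ∀ {i j k : Fin n}, (i, j) ∈ carrier → (j, k) ∈ carrier → (i, k) ∈ carrier

instance instMembershipPosetOn (n : ℕ) : Membership (Fin n × Fin n) (PosetOn n) :=
  ⟨fun P p => p ∈ P.carrier⟩

/-- The poset `[[n]]` of all positions strictly above the diagonal. -/
def fullPoset (n : ℕ) : PosetOn n where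
  carrier := {p | p.1 < p.2}
  lt_of_mem := fun h => h
  trans_mem := fun {i j k} (h : i < j) (h' : j < k) => show i < k from lt_trans h h'

/-- `P ⊲ [[n]]`. -/
def PosetOn.IsNormal {n : ℕ} (P : PosetOn n) : Prop :=
  ∀ i j k l : Fin n, i ≤ j → j < k → k ≤ l → (i, l) ∉ P → (j, k) ∉ P

theorem PosetOn.mem_fullPoset {n : ℕ} (P : PosetOn n) {p : Fin n × Fin n} (h : p ∈ P) :
    p ∈ fullPoset n :=
  show p.1 < p.2 from P.lt_of_mem h

section Groups

variable (F : Type*) [Field F] {n : ℕ} (P : PosetOn n)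

/-- The algebra `𝔫_P` of matrices supported on `P`, as a vector space. -/
def nilp : Submodule F (Matrix (Fin n) (Fin n) F) where
  carrier := {X | ∀ i j, (i, j) ∉ P → X i j = 0}
  zero_mem' := fun _ _ _ => rfl
  add_mem' := fun {X Y} hX hY i j h => by
    rw [Matrix.add_apply, hX i j h, hY i j h, add_zero]
  smul_mem' := fun c X hX i j h => by
    rw [Matrix.smul_apply, hX i j h, smul_zero]

theorem mul_mem_nilp {X Y : Matrix (Fin n) (Fin n) F} (hX : X ∈ nilp F P) (hY : Y ∈ nilp F P) :
    X * Y ∈ nilp F P := by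
  intro i j h
  rw [Matrix.mul_apply]
  refine Finset.sum_eq_zero fun k _ => ?_
  by_cases h1 : (i, k) ∈ P
  · have h2 : (k, j) ∉ P := fun h2 => h (P.trans_mem h1 h2)
    rw [hY k j h2, mul_zero]
  · rw [hX i k h1, zero_mul]

theorem nilp_le_full : nilp F P ≤ nilp F (fullPoset n) :=
  fun _ hX i j h => hX i j fun h' => h (P.mem_fullPoset h')

/-- Membership in `U_P`: ones on the diagonal, zeros off the diagonal outside `P`. -/
def IsPattern (g : Matrix (Fin n) (Fin n) F) : Prop :=
  (∀ i, g i i = 1) ∧ ∀ i j, i ≠ j → (i, j) ∉ P → g i j = 0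

theorem isPattern_iff (g : Matrix (Fin n) (Fin n) F) :
    IsPattern F P g ↔ g - 1 ∈ nilp F P := by
  constructor
  · rintro ⟨h1, h2⟩ i j h
    by_cases hij : i = j
    · subst hij
      rw [Matrix.sub_apply, h1, Matrix.one_apply_eq, sub_self]
    · rw [Matrix.sub_apply, h2 i j hij h, Matrix.one_apply_ne hij, sub_self]
  · intro h
    refine ⟨fun i => ?_, fun i j hij hP => ?_⟩
    · have h1 := h i i fun h' => lt_irrefl i (P.lt_of_mem h')
      rwa [Matrix.sub_apply, Matrix.one_apply_eq, sub_eq_zero] at h1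
    · have h1 := h i j hP
      rwa [Matrix.sub_apply, Matrix.one_apply_ne hij, sub_zero] at h1

theorem isPattern_mul {g h : Matrix (Fin n) (Fin n) F} (hg : IsPattern F P g)
    (hh : IsPattern F P h) : IsPattern F P (g * h) := by
  rw [isPattern_iff] at *
  have e : g * h - 1 = (g - 1) * (h - 1) + (g - 1) + (h - 1) := by noncomm_ring
  rw [e]
  exact add_mem (add_mem (mul_mem_nilp F P hg hh) hg) hh

theorem isPattern_one : IsPattern F P 1 := by
  rw [isPattern_iff, sub_self]
  exact zero_mem _

variable [Finite F]

/-- The pattern group `U_P`, as a subgroup of `GL_n(F)`, for a finite field `F`. -/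
def patternGroup : Subgroup (GL (Fin n) F) where
  carrier := {g | IsPattern F P (g : Matrix (Fin n) (Fin n) F)}
  mul_mem' := fun {g h} hg hh => by
    simpa using isPattern_mul F P hg hh
  one_mem' := by simpa using isPattern_one F P
  inv_mem' := fun {g} hg => by
    have : Finite (GL (Fin n) F) := inferInstance
    have hpow : ∀ m : ℕ, IsPattern F P ((g ^ m : GL (Fin n) F) : Matrix (Fin n) (Fin n) F) := by
      intro m
      induction m with
      | zero => simpa using isPattern_one F P
      | succ m ih =>
        rw [pow_succ]
        simpa using isPattern_mul F P ih hg
    have e : g⁻¹ = g ^ (orderOf g - 1) := by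
      rw [inv_eq_iff_mul_eq_one, ← pow_succ', Nat.sub_add_cancel (orderOf_pos g),
        pow_orderOf_eq_one]
    show IsPattern F P ((g⁻¹ : GL (Fin n) F) : Matrix (Fin n) (Fin n) F)
    rw [e]
    exact hpow _

theorem patternGroup_le_full : patternGroup F P ≤ patternGroup F (fullPoset n) :=
  fun _ hg => ⟨hg.1, fun i j hij h => hg.2 i j hij fun h' => h (P.mem_fullPoset h')⟩

end Groups

section Dual

variable {F : Type*} [Field F] {n : ℕ} {P : PosetOn n}

/-- The elementary matrix `e_{ij}` for a position `(i,j)` of `P`, as an element of `𝔫_P`. -/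
def elemMat {i j : Fin n} (h : (i, j) ∈ P) : nilp F P :=
  ⟨Matrix.single i j 1, fun a b hab => by
    refine Matrix.single_apply_of_ne _ _ _ _ _ ?_
    rintro ⟨rfl, rfl⟩
    exact hab h⟩

open Classical in
/-- The entry `λ_{ij}`: it is `λ(e_{ij})` for `(i,j) ∈ P`, and `0` otherwise. -/
noncomputable def entry (lam : Module.Dual F (nilp F P)) (i j : Fin n) : F :=
  if h : (i, j) ∈ P then lam (elemMat h) else 0

/-- The support of a functional on `𝔫_P`. -/
def supp (lam : Module.Dual F (nilp F P)) : Set (Fin n × Fin n) :=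
  {p | p ∈ P ∧ entry lam p.1 p.2 ≠ 0}

/-- The functional on `𝔫_P` with entries `A i j` at the positions `(i,j) ∈ P`;
the values of `A` at other positions are irrelevant. -/
def ofEntries (A : Fin n → Fin n → F) : Module.Dual F (nilp F P) where
  toFun := fun X => ∑ i, ∑ j, A i j * (X : Matrix (Fin n) (Fin n) F) i j
  map_add' := fun X Y => by
    simp [mul_add, Finset.sum_add_distrib]
  map_smul' := fun c X => by
    simp [Finset.mul_sum, mul_left_comm]

theorem entry_ofEntries (A : Fin n → Fin n → F) {i j : Fin n} (h : (i, j) ∈ P) :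
    entry (ofEntries A : Module.Dual F (nilp F P)) i j = A i j := by
  rw [entry, dif_pos h]
  show ∑ a, ∑ b, A a b * Matrix.single i j (1 : F) a b = A i j
  rw [Finset.sum_eq_single i, Finset.sum_eq_single j]
  · simp
  · intro b _ hb
    rw [Matrix.single_apply_of_ne _ _ _ _ _ (fun h => hb h.2.symm), mul_zero]
  · simp
  · intro a _ ha
    refine Finset.sum_eq_zero fun b _ => ?_
    rw [Matrix.single_apply_of_ne _ _ _ _ _ (fun h => ha h.1.symm), mul_zero]
  · simp

/-- The set `𝒮_P^*` of labeled set partitions: the support has at most one position in each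
row and column. -/
def labeledSetPartitions (F : Type*) [Field F] {n : ℕ} (P : PosetOn n) :
    Set (Module.Dual F (nilp F P)) :=
  {lam | (∀ i j j', (i, j) ∈ supp lam → (i, j') ∈ supp lam → j = j') ∧
    ∀ i i' j, (i, j) ∈ supp lam → (i', j) ∈ supp lam → i = i'}

/-- The restriction to `𝔫_P` of a functional on `𝔫_n`. -/
def restrictDual (P : PosetOn n) (lam : Module.Dual F (nilp F (fullPoset n))) :
    Module.Dual F (nilp F P) :=
  lam.comp (Submodule.inclusion (nilp_le_full F P))

end Dual

section Supercharacters

variable {F : Type*} [Field F] [Finite F] {n : ℕ} {P : PosetOn n}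

instance instFiniteDual : Finite (Module.Dual F (nilp F P)) :=
  Module.finite_of_finite F

/-- `X ↦ gX` on `𝔫_P`, for `g ∈ U_P`. -/
def mulLeft (g : patternGroup F P) : nilp F P →ₗ[F] nilp F P where
  toFun := fun X => ⟨((g : GL (Fin n) F) : Matrix (Fin n) (Fin n) F) * X.1, by
    have e : ((g : GL (Fin n) F) : Matrix (Fin n) (Fin n) F) * X.1
        = (((g : GL (Fin n) F) : Matrix (Fin n) (Fin n) F) - 1) * X.1 + X.1 := by noncomm_ring
    rw [e]
    exact add_mem (mul_mem_nilp F P ((isPattern_iff F P _).1 g.2) X.2) X.2⟩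
  map_add' := fun X Y => Subtype.ext (mul_add _ _ _)
  map_smul' := fun c X => Subtype.ext (mul_smul_comm _ _ _)

/-- `X ↦ Xg` on `𝔫_P`, for `g ∈ U_P`. -/
def mulRight (g : patternGroup F P) : nilp F P →ₗ[F] nilp F P where
  toFun := fun X => ⟨X.1 * ((g : GL (Fin n) F) : Matrix (Fin n) (Fin n) F), by
    have e : X.1 * ((g : GL (Fin n) F) : Matrix (Fin n) (Fin n) F)
        = X.1 * (((g : GL (Fin n) F) : Matrix (Fin n) (Fin n) F) - 1) + X.1 := by noncomm_ring
    rw [e]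
    exact add_mem (mul_mem_nilp F P X.2 ((isPattern_iff F P _).1 g.2)) X.2⟩
  map_add' := fun X Y => Subtype.ext (add_mul _ _ _)
  map_smul' := fun c X => Subtype.ext (smul_mul_assoc _ _ _)

/-- `(gλ)(X) = λ(g⁻¹X)`. -/
def leftAct (g : patternGroup F P) (lam : Module.Dual F (nilp F P)) : Module.Dual F (nilp F P) :=
  lam.comp (mulLeft g⁻¹)

/-- `(λg)(X) = λ(Xg⁻¹)`. -/
def rightAct (lam : Module.Dual F (nilp F P)) (g : patternGroup F P) : Module.Dual F (nilp F P) :=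
  lam.comp (mulRight g⁻¹)

/-- The left orbit `U_P λ`. -/
def leftOrbit (lam : Module.Dual F (nilp F P)) : Set (Module.Dual F (nilp F P)) :=
  {mu | ∃ g : patternGroup F P, mu = leftAct g lam}

/-- The two-sided orbit `U_P λ U_P`. -/
def twoSidedOrbit (lam : Module.Dual F (nilp F P)) : Set (Module.Dual F (nilp F P)) :=
  {mu | ∃ g h : patternGroup F P, mu = rightAct (leftAct g lam) h}

/-- The element `g - 1` of `𝔫_P`, for `g ∈ U_P`. -/
def subOne (g : patternGroup F P) : nilp F P :=
  ⟨((g : GL (Fin n) F) : Matrix (Fin n) (Fin n) F) - 1, (isPattern_iff F P _).1 g.2⟩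

/-- The supercharacter `χ_P^λ` of `U_P`, with respect to the additive character `θ` of `F`.
The sum runs over a finite set. -/
noncomputable def supercharacter (θ : AddChar F ℂ) (lam : Module.Dual F (nilp F P))
    (g : patternGroup F P) : ℂ :=
  ((leftOrbit lam).ncard : ℂ) / ((twoSidedOrbit lam).ncard : ℂ) *
    ∑ᶠ mu ∈ twoSidedOrbit lam, θ (mu (subOne g))

/-- The restriction to `U_P` of a function on `U_n`. -/
def resU (P : PosetOn n) (f : patternGroup F (fullPoset n) → ℂ) : patternGroup F P → ℂ :=
  fun g => f (Subgroup.inclusion (patternGroup_le_full F P) g)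

end Supercharacters

section Combinatorics

variable {F : Type*} [Field F] {n : ℕ} {P : PosetOn n}

/-- `coadj_Q^L(λ)` for `λ ∈ 𝔫_P^*`. -/
def coadjL (Q : PosetOn n) (lam : Module.Dual F (nilp F P)) : Set (Fin n × Fin n) :=
  {p | p ∈ P ∧ ∃ i, (i, p.2) ∈ supp lam ∧ (i, p.1) ∈ Q}

/-- `coadj_Q^R(λ)` for `λ ∈ 𝔫_P^*`. -/
def coadjR (Q : PosetOn n) (lam : Module.Dual F (nilp F P)) : Set (Fin n × Fin n) :=
  {p | p ∈ P ∧ ∃ k, (p.1, k) ∈ supp lam ∧ (p.2, k) ∈ Q}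

/-- `coadj_Q(λ)` for `λ ∈ 𝔫_P^*`. -/
def coadj (Q : PosetOn n) (lam : Module.Dual F (nilp F P)) : Set (Fin n × Fin n) :=
  coadjL Q lam ∪ coadjR Q lam

/-- `coaux_Q^L(λ)` for `λ ∈ 𝔫_P^*`. -/
def coauxL (Q : PosetOn n) (lam : Module.Dual F (nilp F P)) : Set (Fin n × Fin n) :=
  coadjL (fullPoset n) lam \ coadjL Q lam

/-- `coaux_Q^R(λ)` for `λ ∈ 𝔫_P^*`. -/
def coauxR (Q : PosetOn n) (lam : Module.Dual F (nilp F P)) : Set (Fin n × Fin n) :=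
  coadjR (fullPoset n) lam \ coadjR Q lam

/-- `coaux_Q(λ)` for `λ ∈ 𝔫_P^*`. -/
def coaux (Q : PosetOn n) (lam : Module.Dual F (nilp F P)) : Set (Fin n × Fin n) :=
  coadj (fullPoset n) lam \ coadj Q lam

open Classical in
/-- The product `η *_λ μ` on `𝔫_P^*`: its `(j,k)` entry is
`η_{jk} + μ_{jk} + ∑ η_{jl} μ_{ik} λ_{il}⁻¹`, over `(i,l) ∈ supp(λ)` with `i < j < k < l`. -/
noncomputable def starProd (lam eta mu : Module.Dual F (nilp F P)) : Module.Dual F (nilp F P) :=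
  ofEntries fun j k => entry eta j k + entry mu j k +
    ∑ i, ∑ l, if (i, l) ∈ supp lam ∧ i < j ∧ j < k ∧ k < l then
      entry eta j l * entry mu i k * (entry lam i l)⁻¹ else 0

open Classical in
/-- The part of `η` on the positions in `S`. -/
noncomputable def part (S : Set (Fin n × Fin n)) (eta : Module.Dual F (nilp F P)) :
    Module.Dual F (nilp F P) :=
  ofEntries fun i j => if (i, j) ∈ S then entry eta i j else 0

/-- `ℜ^*_λ(η) = η_L *_λ η_{R∖L}`, where `η_L` is the part of `η` on `coaux_P^L(λ)` and `η_{R∖L}`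
its part on `coaux_P^R(λ) - coaux_P^L(λ)`. It is used for `supp(η) ⊆ coaux_P(λ)`, and then
`η = η_L + η_{R∖L}`. -/
noncomputable def repMap (lam eta : Module.Dual F (nilp F P)) : Module.Dual F (nilp F P) :=
  starProd lam (part (coauxL P lam) eta) (part (coauxR P lam \ coauxL P lam) eta)

/-- The supercharacter `χ_P^{(λ,η)}`, indexed by `λ + ℜ^*_λ(η)`. -/
noncomputable def supercharacterPair [Finite F] (θ : AddChar F ℂ)
    (lam eta : Module.Dual F (nilp F P)) : patternGroup F P → ℂ :=
  supercharacter θ (lam + repMap lam eta)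

end Combinatorics

end PatternGroup

/-! Since `P` is closed under moving up and to the right, `nilp F P` is stable under multiplication
by `U_n` on both sides. So `U_n × U_n` acts on its dual, restriction of functionals is equivariant,
and `U_P` is normal in `U_n`.

A supercharacter is the size of a left orbit times an average of `θ` over a two-sided orbit.
Equivariant maps preserve orbit averages (`finsum_biOrbit_map`), so on `U_P` the value of `χ^λ` is
`|U_n λ|` times the average over `U_n μ U_n`. By normality this orbit is a disjoint union of
two-sided `U_P`-orbits that are translates of each other. What remains is to count them and to find
representatives.

Sizes: for a labeled set partition the one-sided orbits are affine spaces in the directions `coadjL`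
and `coadjR` (`mem_lOrbit_iff`, `mem_rOrbit_iff`), and the identity `|AvA| · |Av ∩ vA| = |Av| ·
|vA|` gives `|U_Q μ U_Q| = q ^ |coadj_Q(μ)|` (`ncard_biOrbit`). Hence there are `q ^ |coaux_P(μ)|`
orbits of `U_P`, as many as there are `η`.

Representatives: if `aμ = μ + α` and `μb = μ + β` (with `b` acting through the second factor), then
the pair sends `μ` to `μ + α *_μ β` (`smul_eq_add_starProd`), so every `μ + ℜ^*_μ(η)` lies in `U_n μ
U_n`. Different `η` give different `U_P`-orbits (`eq_of_mem_biOrbit`), so by counting all orbits are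
reached. Comparing powers of `q` gives `c`. -/

namespace PatternGroup

/-! ### Orbit counting for a two-sided action of a finite group -/

section TwoSidedActions

variable {G V : Type*} [Group G] [MulAction (G × G) V]

/-- The left orbit of `v` under a subgroup `A` of `G`. -/
def lOrbit (A : Subgroup G) (v : V) : Set V := {w | ∃ a ∈ A, w = ((a, 1) : G × G) • v}

/-- The right orbit of `v` under a subgroup `A` of `G`. -/
def rOrbit (A : Subgroup G) (v : V) : Set V := {w | ∃ a ∈ A, w = ((1, a) : G × G) • v}

/-- The two-sided orbit of `v` under a subgroup `A` of `G`. -/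
def biOrbit (A : Subgroup G) (v : V) : Set V :=
  {w | ∃ a ∈ A, ∃ b ∈ A, w = ((a, b) : G × G) • v}

theorem mem_biOrbit_self (A : Subgroup G) (v : V) : v ∈ biOrbit A v :=
  ⟨1, A.one_mem, 1, A.one_mem, (one_smul (G × G) v).symm⟩

theorem biOrbit_eq_of_mem {A : Subgroup G} {v w : V} (h : w ∈ biOrbit A v) :
    biOrbit A w = biOrbit A v := by
  obtain ⟨a, ha, b, hb, rfl⟩ := h
  ext u
  constructor
  · rintro ⟨c, hc, d, hd, rfl⟩
    exact ⟨c * a, A.mul_mem hc ha, d * b, A.mul_mem hd hb, by rw [smul_smul]; rfl⟩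
  · rintro ⟨c, hc, d, hd, rfl⟩
    refine ⟨c * a⁻¹, A.mul_mem hc (A.inv_mem ha), d * b⁻¹, A.mul_mem hd (A.inv_mem hb), ?_⟩
    rw [smul_smul, Prod.mk_mul_mk, inv_mul_cancel_right, inv_mul_cancel_right]

theorem biOrbit_mono {A B : Subgroup G} (h : A ≤ B) (v : V) : biOrbit A v ⊆ biOrbit B v := by
  rintro w ⟨a, ha, b, hb, rfl⟩
  exact ⟨a, h ha, b, h hb, rfl⟩

/-- For a normal subgroup, the two-sided orbits of all translates of `v` are translates of the
two-sided orbit of `v`. -/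
theorem biOrbit_smul (N : Subgroup G) [hN : N.Normal] (k : G × G) (v : V) :
    biOrbit N (k • v) = (fun w => k • w) '' biOrbit N v := by
  ext u
  constructor
  · rintro ⟨c, hc, d, hd, rfl⟩
    refine ⟨_, ⟨k.1⁻¹ * c * k.1, by simpa using hN.conj_mem c hc k.1⁻¹, k.2⁻¹ * d * k.2,
      by simpa using hN.conj_mem d hd k.2⁻¹, rfl⟩, ?_⟩
    simp only [smul_smul]
    congr 1
    ext <;> simp [mul_assoc]
  · rintro ⟨_, ⟨c, hc, d, hd, rfl⟩, rfl⟩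
    refine ⟨k.1 * c * k.1⁻¹, hN.conj_mem c hc _, k.2 * d * k.2⁻¹, hN.conj_mem d hd _, ?_⟩
    simp only [smul_smul]
    congr 1
    ext <;> simp [mul_assoc]

theorem lOrbit_smul (N : Subgroup G) [hN : N.Normal] (k : G × G) (v : V) :
    lOrbit N (k • v) = (fun w => k • w) '' lOrbit N v := by
  ext u
  constructor
  · rintro ⟨c, hc, rfl⟩
    refine ⟨_, ⟨k.1⁻¹ * c * k.1, by simpa using hN.conj_mem c hc k.1⁻¹, rfl⟩, ?_⟩
    simp only [smul_smul]
    congr 1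
    ext <;> simp [mul_assoc]
  · rintro ⟨_, ⟨c, hc, rfl⟩, rfl⟩
    refine ⟨k.1 * c * k.1⁻¹, hN.conj_mem c hc _, ?_⟩
    simp only [smul_smul]
    congr 1
    ext <;> simp [mul_assoc]

theorem ncard_biOrbit_smul (N : Subgroup G) [N.Normal] (k : G × G) (v : V) :
    (biOrbit N (k • v)).ncard = (biOrbit N v).ncard := by
  rw [biOrbit_smul, Set.ncard_image_of_injective _ (MulAction.injective k)]

theorem ncard_lOrbit_smul (N : Subgroup G) [N.Normal] (k : G × G) (v : V) :
    (lOrbit N (k • v)).ncard = (lOrbit N v).ncard := by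
  rw [lOrbit_smul, Set.ncard_image_of_injective _ (MulAction.injective k)]

/-- The sum over a group of a function on an orbit. -/
theorem sum_smul_mul_ncard_orbit {K W : Type*} [Group K] [Fintype K] [MulAction K W]
    (T : W → ℂ) (w : W) :
    (∑ k : K, T (k • w)) * ((MulAction.orbit K w).ncard : ℂ)
      = Fintype.card K * ∑ᶠ u ∈ MulAction.orbit K w, T u := by
  classical
  have hfin : (MulAction.orbit K w).Finite := Set.finite_range _
  have : Fintype (MulAction.orbit K w) := hfin.fintype
  have : Fintype (MulAction.stabilizer K w) := Fintype.ofFinite _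
  have hcard := MulAction.card_orbit_mul_card_stabilizer_eq_card_group K w
  have hsum : ∑ k : K, T (k • w)
      = Fintype.card (MulAction.stabilizer K w) * ∑ᶠ u ∈ MulAction.orbit K w, T u := by
    rw [finsum_mem_eq_sum_of_inter_support_eq (t := (MulAction.orbit K w).toFinset) _ (by simp),
      Finset.mul_sum, ← Finset.sum_fiberwise_of_maps_to
        (t := (MulAction.orbit K w).toFinset) (g := fun k : K => k • w) (by simp)]
    refine Finset.sum_congr rfl fun u hu => ?_
    rw [Set.mem_toFinset] at hu
    obtain ⟨k₀, rfl⟩ := hu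
    rw [Finset.sum_congr rfl (g := fun _ => T (k₀ • w))
      (fun k hk => by rw [(Finset.mem_filter.1 hk).2]), Finset.sum_const, nsmul_eq_mul]
    congr 2
    rw [← Fintype.card_coe]
    -- The group elements sending `w` to `k₀ • w` form the coset of the stabilizer through `k₀`.
    refine Fintype.card_congr
      ⟨fun k => ⟨k₀⁻¹ * k.1, ?_⟩, fun s => ⟨k₀ * s.1, ?_⟩, fun k => ?_, fun s => ?_⟩
    · have := (Finset.mem_filter.1 k.2).2
      rw [MulAction.mem_stabilizer_iff, mul_smul]
      simp only at this
      rw [this, inv_smul_smul]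
    · refine Finset.mem_filter.2 ⟨Finset.mem_univ _, ?_⟩
      simp only [mul_smul]
      rw [MulAction.mem_stabilizer_iff.1 s.2]
    · simp
    · simp
  rw [hsum, ← hcard, ← Nat.card_coe_set_eq, Nat.card_eq_fintype_card]
  push_cast
  ring

theorem biOrbit_eq_orbit (A : Subgroup G) (v : V) :
    biOrbit A v = MulAction.orbit (A.prod A) v := by
  ext w
  constructor
  · rintro ⟨a, ha, b, hb, rfl⟩
    exact ⟨⟨(a, b), ha, hb⟩, rfl⟩
  · rintro ⟨⟨⟨a, b⟩, ha, hb⟩, rfl⟩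
    exact ⟨a, ha, b, hb, rfl⟩

theorem lOrbit_eq_orbit (A : Subgroup G) (v : V) :
    lOrbit A v = MulAction.orbit (A.prod (⊥ : Subgroup G)) v := by
  ext w
  constructor
  · rintro ⟨a, ha, rfl⟩
    exact ⟨⟨(a, 1), ha, rfl⟩, rfl⟩
  · rintro ⟨⟨⟨a, b⟩, ha, hb⟩, rfl⟩
    obtain rfl : b = 1 := hb
    exact ⟨a, ha, rfl⟩

theorem sum_left_smul (A : Subgroup G) [Fintype A] (T : V → ℂ) (v : V) :
    (∑ a : A, T (((a : G), (1 : G)) • v)) * ((lOrbit A v).ncard : ℂ)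
      = Fintype.card A * ∑ᶠ u ∈ lOrbit A v, T u := by
  let _ : MulAction A V := MulAction.compHom V ((MonoidHom.inl G G).comp A.subtype)
  have e : lOrbit A v = MulAction.orbit A v := by
    ext w
    exact ⟨fun ⟨a, ha, h⟩ => ⟨⟨a, ha⟩, h.symm⟩, fun ⟨a, h⟩ => ⟨a.1, a.2, h.symm⟩⟩
  rw [e]
  exact sum_smul_mul_ncard_orbit T v

theorem sum_right_smul (A : Subgroup G) [Fintype A] (T : V → ℂ) (v : V) :
    (∑ a : A, T (((1 : G), (a : G)) • v)) * ((rOrbit A v).ncard : ℂ)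
      = Fintype.card A * ∑ᶠ u ∈ rOrbit A v, T u := by
  let _ : MulAction A V := MulAction.compHom V ((MonoidHom.inr G G).comp A.subtype)
  have e : rOrbit A v = MulAction.orbit A v := by
    ext w
    exact ⟨fun ⟨a, ha, h⟩ => ⟨⟨a, ha⟩, h.symm⟩, fun ⟨a, h⟩ => ⟨a.1, a.2, h.symm⟩⟩
  rw [e]
  exact sum_smul_mul_ncard_orbit T v

theorem sum_both_smul (A : Subgroup G) [Fintype A] (T : V → ℂ) (v : V) :
    (∑ b : A, ∑ a : A, T (((a : G), (b : G)) • v)) * ((biOrbit A v).ncard : ℂ)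
      = Fintype.card A * Fintype.card A * ∑ᶠ u ∈ biOrbit A v, T u := by
  let _ : MulAction (A × A) V := MulAction.compHom V (A.subtype.prodMap A.subtype)
  have e : biOrbit A v = MulAction.orbit (A × A) v := by
    ext w
    exact ⟨fun ⟨a, ha, b, hb, h⟩ => ⟨(⟨a, ha⟩, ⟨b, hb⟩), h.symm⟩,
      fun ⟨a, h⟩ => ⟨a.1, a.1.2, a.2, a.2.2, h.symm⟩⟩
  rw [e, ← Nat.cast_mul, ← Fintype.card_prod, ← sum_smul_mul_ncard_orbit T v,
    Fintype.sum_prod_type_right]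
  rfl

variable [Finite G]

theorem biOrbit_finite (A : Subgroup G) (v : V) : (biOrbit A v).Finite := by
  rw [biOrbit_eq_orbit]
  exact Set.finite_range _

theorem lOrbit_finite (A : Subgroup G) (v : V) : (lOrbit A v).Finite := by
  rw [lOrbit_eq_orbit]
  exact Set.finite_range _

theorem ncard_biOrbit_pos (A : Subgroup G) (v : V) : 0 < (biOrbit A v).ncard :=
  (Set.ncard_pos (biOrbit_finite A v)).2 ⟨v, mem_biOrbit_self A v⟩

theorem finsum_mem_indicator_singleton [DecidableEq V] (S : Set V) (w : V) :
    ∑ᶠ u ∈ S, (if u = w then (1 : ℂ) else 0) = S.indicator 1 w := by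
  classical
  rw [finsum_eq_single _ w]
  · by_cases h : w ∈ S <;> simp [h]
  · intro u hu
    simp [hu]

/-- The product of the sizes of the one-sided orbits is the product of the sizes of the two-sided
orbit and of the intersection of the one-sided orbits. -/
theorem ncard_biOrbit_mul (A : Subgroup G) (v : V) :
    (biOrbit A v).ncard * (lOrbit A v ∩ rOrbit A v).ncard
      = (lOrbit A v).ncard * (rOrbit A v).ncard := by
  classical
  have : Fintype A := Fintype.ofFinite _
  have hA : (Fintype.card A : ℂ) ≠ 0 := by exact_mod_cast Fintype.card_ne_zero
  -- The pairs `(a, b)` fixing `v` are counted in two ways: by the two-sided orbit, and by choosing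
  -- first those `b` that carry `v` into its left orbit, then the `a` that match.
  have h1 := sum_both_smul A (fun u => if u = v then (1 : ℂ) else 0) v
  rw [finsum_mem_indicator_singleton, Set.indicator_of_mem (mem_biOrbit_self A v),
    Pi.one_apply, mul_one] at h1
  have h2 : ∀ b : A, (∑ a : A, if ((a : G), ((b⁻¹ : A) : G)) • v = v then (1 : ℂ) else 0)
      * ((lOrbit A v).ncard : ℂ)
        = Fintype.card A * (lOrbit A v).indicator 1 (((1 : G), (b : G)) • v) := by
    intro b
    rw [← finsum_mem_indicator_singleton, ← sum_left_smul]
    congr 1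
    refine Finset.sum_congr rfl fun a _ => ?_
    have e : ((a : G), ((b⁻¹ : A) : G)) = ((1 : G), (b : G))⁻¹ * ((a : G), (1 : G)) := by
      ext <;> simp
    rw [e, mul_smul, inv_smul_eq_iff]
  have h3 := sum_right_smul A ((lOrbit A v).indicator 1) v
  have h4 : ∑ᶠ u ∈ rOrbit A v, (lOrbit A v).indicator (1 : V → ℂ) u
      = ((lOrbit A v ∩ rOrbit A v).ncard : ℂ) := by
    have hf := (lOrbit_finite A v).inter_of_left (rOrbit A v)
    rw [finsum_mem_eq_sum_of_inter_support_eq (t := hf.toFinset), Set.ncard_eq_toFinset_card _ hf,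
      Finset.sum_congr rfl (g := fun _ => (1 : ℂ))]
    · simp
    · intro u hu
      exact Set.indicator_of_mem (hf.mem_toFinset.1 hu).1 _
    · ext u
      simp [and_comm]
  rw [h4] at h3
  have h5 : (∑ b : A, ∑ a : A, if ((a : G), (b : G)) • v = v then (1 : ℂ) else 0)
      * ((lOrbit A v).ncard : ℂ)
      = Fintype.card A * ∑ b : A, (lOrbit A v).indicator 1 (((1 : G), (b : G)) • v) := by
    rw [← Equiv.sum_comp (Equiv.inv A), Finset.sum_mul, Finset.mul_sum]
    exact Finset.sum_congr rfl fun b _ => h2 b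
  have h6 : ((biOrbit A v).ncard : ℂ) * ((lOrbit A v ∩ rOrbit A v).ncard : ℂ)
      = ((lOrbit A v).ncard : ℂ) * ((rOrbit A v).ncard : ℂ) := by
    refine mul_left_cancel₀ (mul_ne_zero hA hA) ?_
    linear_combination (-((biOrbit A v).ncard : ℂ) * Fintype.card A) * h3
      - ((biOrbit A v).ncard : ℂ) * ((rOrbit A v).ncard : ℂ) * h5
      + ((lOrbit A v).ncard : ℂ) * ((rOrbit A v).ncard : ℂ) * h1
  exact_mod_cast h6

/-- Orbit averages are preserved by equivariant maps. -/
theorem finsum_biOrbit_map {W : Type*} [MulAction (G × G) W] (f : V → W)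
    (hf : ∀ (k : G × G) (v : V), f (k • v) = k • f v) (A : Subgroup G) (v : V) (T : W → ℂ) :
    (∑ᶠ u ∈ biOrbit A v, T (f u)) / ((biOrbit A v).ncard : ℂ)
      = (∑ᶠ u ∈ biOrbit A (f v), T u) / ((biOrbit A (f v)).ncard : ℂ) := by
  have : Fintype (A.prod A) := Fintype.ofFinite _
  have h1 := sum_smul_mul_ncard_orbit (K := A.prod A) (fun u => T (f u)) v
  have h2 := sum_smul_mul_ncard_orbit (K := A.prod A) T (f v)
  have hf' : ∀ k : A.prod A, f (k • v) = k • f v := fun k => hf k.1 v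
  simp only [hf', ← biOrbit_eq_orbit] at h1 h2
  have e1 : ((biOrbit A v).ncard : ℂ) ≠ 0 := by exact_mod_cast (ncard_biOrbit_pos A v).ne'
  have e2 : ((biOrbit A (f v)).ncard : ℂ) ≠ 0 := by
    exact_mod_cast (ncard_biOrbit_pos A (f v)).ne'
  have e3 : (Fintype.card (A.prod A) : ℂ) ≠ 0 := by
    exact_mod_cast Fintype.card_ne_zero
  rw [div_eq_div_iff e1 e2]
  refine mul_left_cancel₀ e3 ?_
  linear_combination ((biOrbit A v).ncard : ℂ) * h2 - ((biOrbit A (f v)).ncard : ℂ) * h1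

/-- If representatives of distinct `N`-orbits in a `G`-orbit are as many as the quotient of the
orbit sizes, then the `N`-orbits cover the `G`-orbit. -/
theorem finsum_biOrbit_eq_sum {ι : Type*} (N : Subgroup G) [N.Normal] (v : V) (S : Set ι)
    (hS : S.Finite) (r : ι → V) (hr : ∀ i ∈ S, r i ∈ biOrbit (⊤ : Subgroup G) v)
    (hinj : ∀ i ∈ S, ∀ j ∈ S, r i ∈ biOrbit N (r j) → i = j)
    (hcard : S.ncard * (biOrbit N v).ncard = (biOrbit (⊤ : Subgroup G) v).ncard) (T : V → ℂ) :
    ∑ᶠ i ∈ S, ∑ᶠ u ∈ biOrbit N (r i), T u = ∑ᶠ u ∈ biOrbit (⊤ : Subgroup G) v, T u := by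
  have hdisj : S.PairwiseDisjoint fun i => biOrbit N (r i) := by
    intro i hi j hj hij
    refine Set.disjoint_left.2 fun u h1 h2 => hij (hinj i hi j hj ?_)
    rw [← biOrbit_eq_of_mem h2, biOrbit_eq_of_mem h1]
    exact mem_biOrbit_self _ _
  have hsize : ∀ i ∈ S, (biOrbit N (r i)).ncard = (biOrbit N v).ncard := by
    intro i hi
    obtain ⟨a, -, b, -, h⟩ := hr i hi
    rw [h, ncard_biOrbit_smul]
  -- The pieces are disjoint, of equal size and contained in the large orbit; `hcard` says that
  -- their total size is already that of the large orbit.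
  have hunion : ⋃ i ∈ S, biOrbit N (r i) = biOrbit (⊤ : Subgroup G) v := by
    refine Set.eq_of_subset_of_ncard_le ?_ ?_ (biOrbit_finite _ _)
    · refine Set.iUnion₂_subset fun i hi => ?_
      rw [← biOrbit_eq_of_mem (hr i hi)]
      exact biOrbit_mono le_top _
    · rw [← hcard, hS.ncard_biUnion (fun i _ => biOrbit_finite N (r i)) hdisj,
        finsum_mem_congr rfl hsize, finsum_mem_eq_finite_toFinset_sum _ hS, Finset.sum_const,
        smul_eq_mul, Set.ncard_eq_toFinset_card _ hS]
  rw [← hunion, finsum_mem_biUnion hdisj hS (fun i _ => biOrbit_finite N (r i))]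

end TwoSidedActions

/-! ### Functionals as arrays of entries -/

section Entries

variable {F : Type*} [Field F] {n : ℕ} {P : PosetOn n}

theorem entry_of_notMem (f : Module.Dual F (nilp F P)) {i j : Fin n} (h : (i, j) ∉ P) :
    entry f i j = 0 := dif_neg h

theorem entry_of_mem (f : Module.Dual F (nilp F P)) {i j : Fin n} (h : (i, j) ∈ P) :
    entry f i j = f (elemMat h) := dif_pos h

theorem entry_add (f g : Module.Dual F (nilp F P)) (i j : Fin n) :
    entry (f + g) i j = entry f i j + entry g i j := by
  by_cases h : (i, j) ∈ P
  · simp [entry_of_mem _ h]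
  · simp [entry_of_notMem _ h]

theorem entry_sub (f g : Module.Dual F (nilp F P)) (i j : Fin n) :
    entry (f - g) i j = entry f i j - entry g i j := by
  by_cases h : (i, j) ∈ P
  · simp [entry_of_mem _ h]
  · simp [entry_of_notMem _ h]

theorem mem_supp_iff (f : Module.Dual F (nilp F P)) (i j : Fin n) :
    (i, j) ∈ supp f ↔ entry f i j ≠ 0 :=
  ⟨fun h => h.2, fun h => ⟨by_contra fun h' => h (entry_of_notMem f h'), h⟩⟩

theorem supp_subset_iff (f : Module.Dual F (nilp F P)) (S : Set (Fin n × Fin n)) :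
    supp f ⊆ S ↔ ∀ i j, (i, j) ∉ S → entry f i j = 0 := by
  constructor
  · intro h i j hij
    by_contra h0
    exact hij (h ((mem_supp_iff f i j).2 h0))
  · rintro h ⟨i, j⟩ hij
    by_contra h0
    exact (mem_supp_iff f i j).1 hij (h i j h0)

theorem apply_eq_sum_entry (f : Module.Dual F (nilp F P)) (X : nilp F P) :
    f X = ∑ i, ∑ j, entry f i j * X.1 i j := by
  classical
  have e : X = ∑ i, ∑ j, if h : (i, j) ∈ P then X.1 i j • (elemMat h : nilp F P) else 0 := by
    refine Subtype.ext ?_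
    simp only [AddSubmonoidClass.coe_finsetSum]
    conv_lhs => rw [Matrix.matrix_eq_sum_single X.1]
    refine Finset.sum_congr rfl fun i _ => Finset.sum_congr rfl fun j _ => ?_
    by_cases h : (i, j) ∈ P
    · simp [h, elemMat]
    · simp [h, X.2 i j h]
  conv_lhs => rw [e]
  simp only [map_sum]
  refine Finset.sum_congr rfl fun i _ => Finset.sum_congr rfl fun j _ => ?_
  by_cases h : (i, j) ∈ P
  · simp [h, entry_of_mem _ h, mul_comm]
  · simp [h, entry_of_notMem _ h]

theorem ext_entry {f g : Module.Dual F (nilp F P)}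
    (h : ∀ i j, (i, j) ∈ P → entry f i j = entry g i j) : f = g := by
  refine LinearMap.ext fun X => ?_
  rw [apply_eq_sum_entry, apply_eq_sum_entry]
  refine Finset.sum_congr rfl fun i _ => Finset.sum_congr rfl fun j _ => ?_
  by_cases hij : (i, j) ∈ P
  · rw [h i j hij]
  · rw [entry_of_notMem _ hij, entry_of_notMem _ hij]

/-- The functionals supported on a set `S` of positions are counted by functions on `S`. -/
theorem ncard_supp_subset {S : Set (Fin n × Fin n)} (hS : ∀ p ∈ S, p ∈ P) :
    {f : Module.Dual F (nilp F P) | supp f ⊆ S}.ncard = Nat.card F ^ S.ncard := by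
  classical
  rw [← Nat.card_coe_set_eq, ← Nat.card_coe_set_eq S, ← Nat.card_fun]
  refine Nat.card_congr ⟨fun f p => entry f.1 p.1.1 p.1.2,
    fun a => ⟨ofEntries fun i j => if h : (i, j) ∈ S then a ⟨(i, j), h⟩ else 0, ?_⟩, ?_, ?_⟩
  · refine (supp_subset_iff _ _).2 fun i j hij => ?_
    by_cases h : (i, j) ∈ P
    · rw [entry_ofEntries _ h, dif_neg hij]
    · exact entry_of_notMem _ h
  · intro f
    refine Subtype.ext (ext_entry fun i j h => ?_)
    rw [entry_ofEntries _ h]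
    by_cases hij : (i, j) ∈ S
    · rw [dif_pos hij]
    · rw [dif_neg hij, (supp_subset_iff _ _).1 f.2 i j hij]
  · intro a
    funext p
    simp only
    rw [entry_ofEntries _ (hS _ p.2), dif_pos p.2]

theorem entry_part (S : Set (Fin n × Fin n)) [DecidablePred (· ∈ S)]
    (f : Module.Dual F (nilp F P)) (i j : Fin n) :
    entry (part S f) i j = if (i, j) ∈ S then entry f i j else 0 := by
  by_cases h : (i, j) ∈ P
  · rw [part, entry_ofEntries _ h]
    congr
  · rw [entry_of_notMem _ h, entry_of_notMem _ h, ite_self]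

end Entries

/-! ### Normal posets -/

section Poset

variable {n : ℕ}

theorem isNormal_fullPoset : (fullPoset n).IsNormal :=
  fun i j k l hij _ hkl h h' => h (show i < l from hij.trans_lt ((show j < k from h').trans_le hkl))

theorem PosetOn.IsNormal.mem_of_le {P : PosetOn n} (hP : P.IsNormal) {i j k l : Fin n}
    (hij : i ≤ j) (hkl : k ≤ l) (h : (j, k) ∈ P) : (i, l) ∈ P :=
  by_contra fun h' => hP i j k l hij (P.lt_of_mem h) hkl h' h

/-- Allows one action, defined for normal `P`, to serve both `𝔫_n^*` and `𝔫_P^*`. -/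
instance : Fact (fullPoset n).IsNormal := ⟨isNormal_fullPoset⟩

end Poset

/-! ### The two-sided action of `U_n` on `𝔫_P^*` -/

section Action

variable {F : Type*} [Field F] {n : ℕ} {P : PosetOn n}

theorem IsPattern.apply_eq_zero {g : Matrix (Fin n) (Fin n) F} (hg : IsPattern F P g)
    {i j : Fin n} (hij : j < i) : g i j = 0 :=
  hg.2 i j hij.ne' fun h => (P.lt_of_mem h).not_gt hij

theorem pattern_mul_mem_nilp (hP : P.IsNormal) {g X : Matrix (Fin n) (Fin n) F}
    (hg : IsPattern F (fullPoset n) g) (hX : X ∈ nilp F P) : g * X ∈ nilp F P := by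
  intro i j h
  rw [Matrix.mul_apply]
  refine Finset.sum_eq_zero fun k _ => ?_
  rcases lt_or_ge k i with hk | hk
  · rw [hg.apply_eq_zero hk, zero_mul]
  · rw [hX k j fun h' => h (hP.mem_of_le hk le_rfl h'), mul_zero]

theorem mul_pattern_mem_nilp (hP : P.IsNormal) {g X : Matrix (Fin n) (Fin n) F}
    (hg : IsPattern F (fullPoset n) g) (hX : X ∈ nilp F P) : X * g ∈ nilp F P := by
  intro i j h
  rw [Matrix.mul_apply]
  refine Finset.sum_eq_zero fun k _ => ?_
  rcases lt_or_ge j k with hk | hk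
  · rw [hg.apply_eq_zero hk, mul_zero]
  · rw [hX i k fun h' => h (hP.mem_of_le le_rfl hk h'), zero_mul]

variable [Finite F]

/-- The group `U_n`. -/
abbrev Uni (F : Type*) [Field F] [Finite F] (n : ℕ) := patternGroup F (fullPoset n)

/-- The matrix of an element of `U_n`. -/
abbrev mat (g : Uni F n) : Matrix (Fin n) (Fin n) F := ((g : GL (Fin n) F) : Matrix (Fin n) (Fin n) F)

/-- `U_P`, as a subgroup of `U_n`. -/
abbrev subU (F : Type*) [Field F] [Finite F] (P : PosetOn n) : Subgroup (Uni F n) :=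
  (patternGroup F P).subgroupOf (patternGroup F (fullPoset n))

theorem mem_subU {g : Uni F n} : g ∈ subU F P ↔ IsPattern F P (mat g) := Iff.rfl

/-- Existence of the element `1 + Y` of `U_n`. -/
theorem exists_mat_eq_one_add {Q : PosetOn n} {Y : Matrix (Fin n) (Fin n) F} (hY : Y ∈ nilp F Q) :
    ∃ g ∈ subU F Q, mat g = 1 + Y := by
  have hpat : IsPattern F Q (1 + Y) := (isPattern_iff F Q _).2 (by simpa using hY)
  have hdet : (1 + Y).det ≠ 0 := by
    rw [Matrix.det_of_isUpperTriangular]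
    · simp [hpat.1]
    · exact fun i j hij => hpat.apply_eq_zero hij
  exact ⟨⟨Matrix.GeneralLinearGroup.mkOfDetNeZero _ hdet,
    hpat.1, fun i j hij h => hpat.2 i j hij fun h' => h (Q.mem_fullPoset h')⟩, hpat, rfl⟩

variable [hP : Fact P.IsNormal]

/-- `X ↦ aXb` on `𝔫_P`, for `a, b ∈ U_n` and `P ⊲ [[n]]`. -/
def mulBoth (a b : Uni F n) : nilp F P →ₗ[F] nilp F P where
  toFun := fun X => ⟨mat a * X.1 * mat b,
    mul_pattern_mem_nilp hP.out b.2 (pattern_mul_mem_nilp hP.out a.2 X.2)⟩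
  map_add' := fun X Y => Subtype.ext (by simp [mul_add, add_mul])
  map_smul' := fun c X => Subtype.ext (by simp)

theorem coe_mulBoth (a b : Uni F n) (X : nilp F P) :
    (mulBoth a b X : Matrix (Fin n) (Fin n) F) = mat a * X.1 * mat b := rfl

/-- The two-sided action of `U_n` on `𝔫_P^*`: `((a, b)λ)(X) = λ(a⁻¹Xb)`. -/
instance instMulActionDual : MulAction (Uni F n × Uni F n) (Module.Dual F (nilp F P)) where
  smul k f := f.comp (mulBoth k.1⁻¹ k.2)
  one_smul f := LinearMap.ext fun X => by
    show f _ = f _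
    congr 1
    refine Subtype.ext ?_
    simp [coe_mulBoth, mat]
  mul_smul k k' f := LinearMap.ext fun X => by
    show f _ = f _
    congr 1
    refine Subtype.ext ?_
    simp [coe_mulBoth, mat, mul_assoc]

theorem smul_dual_apply (k : Uni F n × Uni F n) (f : Module.Dual F (nilp F P)) (X : nilp F P) :
    (k • f) X = f (mulBoth k.1⁻¹ k.2 X) := rfl

theorem smul_dual_add (k : Uni F n × Uni F n) (f g : Module.Dual F (nilp F P)) :
    k • (f + g) = k • f + k • g := rfl

theorem smul_dual_sub (k : Uni F n × Uni F n) (f g : Module.Dual F (nilp F P)) :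
    k • (f - g) = k • f - k • g := rfl

theorem subU_full : subU F (fullPoset n) = ⊤ := Subgroup.subgroupOf_self _

theorem leftOrbit_eq_lOrbit (f : Module.Dual F (nilp F P)) :
    leftOrbit f = lOrbit (subU F P) f := by
  ext w
  constructor
  · rintro ⟨g, rfl⟩
    refine ⟨⟨g.1, patternGroup_le_full F P g.2⟩, g.2, LinearMap.ext fun X => ?_⟩
    show f _ = f _
    congr 1
    refine Subtype.ext ?_
    simp [coe_mulBoth, mat, mulLeft]
  · rintro ⟨g, hg, rfl⟩
    refine ⟨⟨g.1, hg⟩, LinearMap.ext fun X => ?_⟩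
    show f _ = f _
    congr 1
    refine Subtype.ext ?_
    simp [coe_mulBoth, mat, mulLeft]

/-- `rightAct` by `h` is the action of `(1, h⁻¹)`; the inversion does not change the orbit. -/
theorem twoSidedOrbit_eq_biOrbit (f : Module.Dual F (nilp F P)) :
    twoSidedOrbit f = biOrbit (subU F P) f := by
  ext w
  constructor
  · rintro ⟨g, h, rfl⟩
    refine ⟨⟨g.1, patternGroup_le_full F P g.2⟩, g.2,
      ⟨(h⁻¹).1, patternGroup_le_full F P (h⁻¹).2⟩, (h⁻¹).2, LinearMap.ext fun X => ?_⟩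
    show f _ = f _
    congr 1
    refine Subtype.ext ?_
    simp [coe_mulBoth, mat, mulLeft, mulRight, mul_assoc]
  · rintro ⟨g, hg, h, hh, rfl⟩
    refine ⟨⟨g.1, hg⟩, ⟨h.1, hh⟩⁻¹, LinearMap.ext fun X => ?_⟩
    show f _ = f _
    congr 1
    refine Subtype.ext ?_
    simp [coe_mulBoth, mat, mulLeft, mulRight, mul_assoc]

theorem restrictDual_smul (k : Uni F n × Uni F n)
    (f : Module.Dual F (nilp F (fullPoset n))) :
    restrictDual P (k • f) = k • restrictDual P f := rfl

/-- Conjugation maps `1 + X` to `1 + gXg⁻¹`, and `nilp F P` absorbs `U_n` on both sides. -/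
instance subU_normal : (subU F P).Normal where
  conj_mem a ha g := by
    rw [mem_subU, isPattern_iff] at *
    have e : mat (g * a * g⁻¹) - 1 = mat g * (mat a - 1) * mat g⁻¹ := by
      have h : mat g * mat g⁻¹ = 1 := by simp [mat]
      rw [mul_sub, sub_mul, mul_one, h]
      simp [mat]
    rw [e]
    exact mul_pattern_mem_nilp hP.out g⁻¹.2 (pattern_mul_mem_nilp hP.out g.2 ha)

theorem entry_lsmul (a : Uni F n) (f : Module.Dual F (nilp F P)) {j k : Fin n}
    (h : (j, k) ∈ P) :
    entry ((a, (1 : Uni F n)) • f) j k = ∑ i, mat a⁻¹ i j * entry f i k := by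
  rw [entry_of_mem _ h, smul_dual_apply, apply_eq_sum_entry]
  refine Finset.sum_congr rfl fun i _ => ?_
  rw [Finset.sum_eq_single k]
  · simp [coe_mulBoth, elemMat, mat, mul_comm]
  · intro l _ hl
    simp [coe_mulBoth, elemMat, mat, Matrix.mul_single_apply_of_ne _ _ _ _ _ hl]
  · simp

theorem entry_rsmul (b : Uni F n) (f : Module.Dual F (nilp F P)) {j k : Fin n}
    (h : (j, k) ∈ P) :
    entry (((1 : Uni F n), b) • f) j k = ∑ l, entry f j l * mat b k l := by
  rw [entry_of_mem _ h, smul_dual_apply, apply_eq_sum_entry, Finset.sum_eq_single j]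
  · refine Finset.sum_congr rfl fun l _ => ?_
    simp [coe_mulBoth, elemMat, mat]
  · intro i _ hi
    refine Finset.sum_eq_zero fun l _ => ?_
    simp [coe_mulBoth, elemMat, mat, hi]
  · simp

end Action

/-! ### Orbits of labeled set partitions -/

section Orbits

variable {F : Type*} [Field F] {n : ℕ} {P : PosetOn n} {m : Module.Dual F (nilp F P)}

theorem eq_zero_of_labeled_row (hm : m ∈ labeledSetPartitions F P) {i k l : Fin n}
    (h : (i, k) ∈ supp m) (hl : l ≠ k) : entry m i l = 0 :=
  by_contra fun h' => hl (hm.1 i l k ((mem_supp_iff m i l).2 h') h)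

theorem eq_zero_of_labeled_col (hm : m ∈ labeledSetPartitions F P) {i j k : Fin n}
    (h : (i, k) ∈ supp m) (hj : j ≠ i) : entry m j k = 0 :=
  by_contra fun h' => hj (hm.2 j i k ((mem_supp_iff m j k).2 h') h)

theorem ncard_sub_supp_subset {S : Set (Fin n × Fin n)} (hS : ∀ p ∈ S, p ∈ P) :
    {w : Module.Dual F (nilp F P) | supp (w - m) ⊆ S}.ncard = Nat.card F ^ S.ncard := by
  rw [← ncard_supp_subset (F := F) hS,
    ← Set.ncard_image_of_injective _ (sub_left_injective (b := m))]
  congr 1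
  ext f
  constructor
  · rintro ⟨w, hw, rfl⟩
    exact hw
  · exact fun hf => ⟨f + m, by simpa using hf, add_sub_cancel_right f m⟩

variable [Finite F]

theorem mat_sub_one_mem {Q : PosetOn n} {g : Uni F n} (hg : g ∈ subU F Q) :
    mat g - 1 ∈ nilp F Q := (isPattern_iff F Q _).1 (mem_subU.1 hg)

theorem mat_apply_self (g : Uni F n) (i : Fin n) : mat g i i = 1 := g.2.1 i

theorem mat_apply_of_lt (g : Uni F n) {i j : Fin n} (h : j < i) : mat g i j = 0 :=
  IsPattern.apply_eq_zero g.2 h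

variable [hP : Fact P.IsNormal]

theorem entry_lsmul_sub (a : Uni F n) (f : Module.Dual F (nilp F P)) {j k : Fin n}
    (h : (j, k) ∈ P) :
    entry ((a, (1 : Uni F n)) • f - f) j k = ∑ i, (mat a⁻¹ - 1) i j * entry f i k := by
  rw [entry_sub, entry_lsmul a f h]
  simp [sub_mul, Matrix.one_apply]

theorem entry_rsmul_sub (b : Uni F n) (f : Module.Dual F (nilp F P)) {j k : Fin n}
    (h : (j, k) ∈ P) :
    entry (((1 : Uni F n), b) • f - f) j k = ∑ l, entry f j l * (mat b - 1) k l := by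
  rw [entry_sub, entry_rsmul b f h]
  simp [mul_sub, Matrix.one_apply]

/-- The left orbit of a labeled set partition is an affine space. -/
theorem mem_lOrbit_iff (hm : m ∈ labeledSetPartitions F P) (Q : PosetOn n)
    (w : Module.Dual F (nilp F P)) :
    w ∈ lOrbit (subU F Q) m ↔ supp (w - m) ⊆ coadjL Q m := by
  classical
  rw [supp_subset_iff]
  constructor
  · rintro ⟨a, ha, rfl⟩ j k hjk
    by_cases h : (j, k) ∈ P
    · rw [entry_lsmul_sub a m h]
      refine Finset.sum_eq_zero fun i _ => ?_
      by_cases hi : (i, k) ∈ supp m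
      · rw [mat_sub_one_mem (inv_mem ha) i j fun h' => hjk ⟨h, i, hi, h'⟩, zero_mul]
      · rw [mem_supp_iff, not_not] at hi
        rw [hi, mul_zero]
    · exact entry_of_notMem _ h
  · intro hw
    -- Solves `Y i j * m_{ik} = (w - m)_{jk}`. Row `i` of `m` has at most one nonzero entry, so with
    -- `0⁻¹ = 0` the sum has at most one nonzero term; and distinct columns `k` involve distinct
    -- rows of `Y`, so the equations do not conflict.
    let Y : Matrix (Fin n) (Fin n) F := fun i j =>
      if (i, j) ∈ Q then ∑ k, (entry m i k)⁻¹ * entry (w - m) j k else 0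
    have hY : Y ∈ nilp F Q := fun i j h => if_neg h
    obtain ⟨g, hg, hgY⟩ := exists_mat_eq_one_add hY
    refine ⟨g⁻¹, inv_mem hg, ext_entry fun j k h => ?_⟩
    have key : entry (w - m) j k = entry ((g⁻¹, (1 : Uni F n)) • m - m) j k := by
      rw [entry_lsmul_sub _ m h, inv_inv, hgY, add_sub_cancel_left]
      by_cases hjk : (j, k) ∈ coadjL Q m
      · obtain ⟨-, i, hi, hij⟩ := hjk
        simp only at hi hij
        rw [Finset.sum_eq_single i]
        · show _ = (if (i, j) ∈ Q then ∑ k, (entry m i k)⁻¹ * entry (w - m) j k else 0) * _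
          rw [if_pos hij, Finset.sum_eq_single k]
          · have := (mem_supp_iff m i k).1 hi
            field_simp
          · intro l _ hl
            rw [eq_zero_of_labeled_row hm hi hl, inv_zero, zero_mul]
          · simp
        · intro i' _ hi'
          rw [eq_zero_of_labeled_col hm hi hi', mul_zero]
        · simp
      · rw [hw j k hjk]
        refine (Finset.sum_eq_zero fun i _ => ?_).symm
        by_cases hi : (i, k) ∈ supp m
        · rw [hY i j fun h' => hjk ⟨h, i, hi, h'⟩, zero_mul]
        · rw [mem_supp_iff, not_not] at hi
          rw [hi, mul_zero]
    rw [entry_sub, entry_sub] at key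
    exact sub_left_injective key

/-- The right orbit of a labeled set partition is an affine space. -/
theorem mem_rOrbit_iff (hm : m ∈ labeledSetPartitions F P) (Q : PosetOn n)
    (w : Module.Dual F (nilp F P)) :
    w ∈ rOrbit (subU F Q) m ↔ supp (w - m) ⊆ coadjR Q m := by
  classical
  rw [supp_subset_iff]
  constructor
  · rintro ⟨a, ha, rfl⟩ j k hjk
    by_cases h : (j, k) ∈ P
    · rw [entry_rsmul_sub a m h]
      refine Finset.sum_eq_zero fun l _ => ?_
      by_cases hl : (j, l) ∈ supp m
      · rw [mat_sub_one_mem ha k l fun h' => hjk ⟨h, l, hl, h'⟩, mul_zero]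
      · rw [mem_supp_iff, not_not] at hl
        rw [hl, zero_mul]
    · exact entry_of_notMem _ h
  · intro hw
    -- The transposed system `m_{jl} * Y k l = (w - m)_{jk}`, with the same convention `0⁻¹ = 0`.
    let Y : Matrix (Fin n) (Fin n) F := fun k l =>
      if (k, l) ∈ Q then ∑ j, (entry m j l)⁻¹ * entry (w - m) j k else 0
    have hY : Y ∈ nilp F Q := fun i j h => if_neg h
    obtain ⟨g, hg, hgY⟩ := exists_mat_eq_one_add hY
    refine ⟨g, hg, ext_entry fun j k h => ?_⟩
    have key : entry (w - m) j k = entry (((1 : Uni F n), g) • m - m) j k := by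
      rw [entry_rsmul_sub _ m h, hgY, add_sub_cancel_left]
      by_cases hjk : (j, k) ∈ coadjR Q m
      · obtain ⟨-, l, hl, hkl⟩ := hjk
        simp only at hl hkl
        rw [Finset.sum_eq_single l]
        · show _ = _ * (if (k, l) ∈ Q then ∑ j, (entry m j l)⁻¹ * entry (w - m) j k else 0)
          rw [if_pos hkl, Finset.sum_eq_single j]
          · have := (mem_supp_iff m j l).1 hl
            field_simp
          · intro i _ hi
            rw [eq_zero_of_labeled_col hm hl hi, inv_zero, zero_mul]
          · simp
        · intro l' _ hl'
          rw [eq_zero_of_labeled_row hm hl hl', zero_mul]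
        · simp
      · rw [hw j k hjk]
        refine (Finset.sum_eq_zero fun l _ => ?_).symm
        by_cases hl : (j, l) ∈ supp m
        · rw [hY k l fun h' => hjk ⟨h, l, hl, h'⟩, mul_zero]
        · rw [mem_supp_iff, not_not] at hl
          rw [hl, zero_mul]
    rw [entry_sub, entry_sub] at key
    exact sub_left_injective key

theorem ncard_lOrbit (hm : m ∈ labeledSetPartitions F P) (Q : PosetOn n) :
    (lOrbit (subU F Q) m).ncard = Nat.card F ^ (coadjL Q m).ncard := by
  rw [← ncard_sub_supp_subset (P := P) (m := m) fun p hp => hp.1]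
  congr 1
  exact Set.ext (mem_lOrbit_iff hm Q)

theorem ncard_rOrbit (hm : m ∈ labeledSetPartitions F P) (Q : PosetOn n) :
    (rOrbit (subU F Q) m).ncard = Nat.card F ^ (coadjR Q m).ncard := by
  rw [← ncard_sub_supp_subset (P := P) (m := m) fun p hp => hp.1]
  congr 1
  exact Set.ext (mem_rOrbit_iff hm Q)

/-- The intersection of the two one-sided orbits is again affine, in the direction `coadjL ∩
coadjR`, so inclusion–exclusion in the exponents of `ncard_biOrbit_mul` leaves the union. -/
theorem ncard_biOrbit (hm : m ∈ labeledSetPartitions F P) (Q : PosetOn n) :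
    (biOrbit (subU F Q) m).ncard = Nat.card F ^ (coadj Q m).ncard := by
  have h1 : (lOrbit (subU F Q) m ∩ rOrbit (subU F Q) m).ncard
      = Nat.card F ^ (coadjL Q m ∩ coadjR Q m).ncard := by
    rw [← ncard_sub_supp_subset (P := P) (m := m) fun p hp => hp.1.1]
    congr 1
    ext w
    rw [Set.mem_inter_iff, mem_lOrbit_iff hm, mem_rOrbit_iff hm, ← Set.subset_inter_iff]
    rfl
  have h2 := ncard_biOrbit_mul (subU F Q) m
  rw [h1, ncard_lOrbit hm, ncard_rOrbit hm, ← pow_add,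
    ← Set.ncard_union_add_ncard_inter, pow_add] at h2
  exact Nat.eq_of_mul_eq_mul_right (pow_pos Nat.card_pos _) h2

/-- Applying `a` to `m + β` yields `m + α + β` and the correction `aβ - β`. This depends on `a` only
through entries that `α` already determines, which produces the bilinear term of `starProd`. -/
theorem smul_eq_add_starProd (hm : m ∈ labeledSetPartitions F P)
    {α β : Module.Dual F (nilp F P)} {a b : Uni F n}
    (ha : (a, (1 : Uni F n)) • m = m + α) (hb : ((1 : Uni F n), b) • m = m + β) :
    (a, b) • m = m + starProd m α β := by
  classical
  have hβ : ∀ i k, (i, k) ∉ coadjR (fullPoset n) m → entry β i k = 0 := by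
    have h : ((1 : Uni F n), b) • m ∈ rOrbit (subU F (fullPoset n)) m :=
      ⟨b, by rw [subU_full]; trivial, rfl⟩
    rwa [mem_rOrbit_iff hm, hb, add_sub_cancel_left, supp_subset_iff] at h
  have e : (a, b) • m = m + α + ((a, (1 : Uni F n)) • β - β) + β := by
    have : (a, b) = (a, (1 : Uni F n)) * ((1 : Uni F n), b) := by simp
    rw [this, mul_smul, hb, smul_dual_add, ha]
    abel
  refine ext_entry fun j k h => ?_
  rw [e]
  simp only [entry_add, entry_lsmul_sub a β h, starProd, entry_ofEntries _ h]
  have key : ∑ i, (mat a⁻¹ - 1) i j * entry β i k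
      = ∑ i, ∑ l, if (i, l) ∈ supp m ∧ i < j ∧ j < k ∧ k < l then
        entry α j l * entry β i k * (entry m i l)⁻¹ else 0 := by
    refine Finset.sum_congr rfl fun i _ => ?_
    by_cases hik : (i, k) ∈ coadjR (fullPoset n) m
    · obtain ⟨-, l, hl, hkl⟩ := hik
      simp only at hl
      replace hkl : k < l := hkl
      rw [Finset.sum_eq_single l]
      · by_cases hij : i < j
        · rw [if_pos ⟨hl, hij, P.lt_of_mem h, hkl⟩]
          -- Column `l` of `m` has its only nonzero entry in row `i`, so `α_{jl}` recovers the
          -- needed entry of `a⁻¹ - 1`. Normality puts `(j, l)` in `P`, since `(j, k)` is there and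
          -- `k < l`.
          have hα : entry α j l = (mat a⁻¹ - 1) i j * entry m i l := by
            have h1 := entry_lsmul_sub a m (hP.out.mem_of_le le_rfl hkl.le h)
            rw [ha, add_sub_cancel_left] at h1
            rw [h1, Finset.sum_eq_single i]
            · intro i' _ hi'
              rw [eq_zero_of_labeled_col hm hl hi', mul_zero]
            · simp
          have := (mem_supp_iff m i l).1 hl
          rw [hα]
          field_simp
        · rw [if_neg fun h' => hij h'.2.1]
          have h0 : (mat a⁻¹ - 1) i j = 0 :=
            mat_sub_one_mem (Q := fullPoset n) (g := a⁻¹) (by rw [subU_full]; trivial) i j hij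
          rw [h0, zero_mul]
      · intro l' _ hl'
        rw [if_neg fun h' => hl' (hm.1 _ _ _ h'.1 hl)]
      · simp
    · rw [hβ i k hik, mul_zero]
      simp
  rw [key]
  ring

/-- The left action adds to each row multiples of the rows above it, and `coadjL P m` is closed
under moving down inside `P`, by normality. -/
theorem supp_lsmul_subset_coadjL {f : Module.Dual F (nilp F P)} (hf : supp f ⊆ coadjL P m)
    (a : Uni F n) : supp ((a, (1 : Uni F n)) • f) ⊆ coadjL P m := by
  rw [supp_subset_iff] at *
  intro j k hjk
  by_cases h : (j, k) ∈ P
  · rw [entry_lsmul a f h]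
    refine Finset.sum_eq_zero fun i _ => ?_
    rcases lt_or_ge j i with hij | hij
    · rw [mat_apply_of_lt _ hij, zero_mul]
    · rw [hf i k, mul_zero]
      rintro ⟨-, i', h1, h2⟩
      exact hjk ⟨h, i', h1, hP.out.mem_of_le le_rfl hij h2⟩
  · exact entry_of_notMem _ h

theorem supp_rsmul_subset_coadjR {f : Module.Dual F (nilp F P)} (hf : supp f ⊆ coadjR P m)
    (b : Uni F n) : supp (((1 : Uni F n), b) • f) ⊆ coadjR P m := by
  rw [supp_subset_iff] at *
  intro j k hjk
  by_cases h : (j, k) ∈ P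
  · rw [entry_rsmul b f h]
    refine Finset.sum_eq_zero fun l _ => ?_
    rcases lt_or_ge l k with hlk | hlk
    · rw [mat_apply_of_lt _ hlk, mul_zero]
    · rw [hf j l, zero_mul]
      rintro ⟨-, l', h1, h2⟩
      exact hjk ⟨h, l', h1, hP.out.mem_of_le hlk le_rfl h2⟩
  · exact entry_of_notMem _ h

/-- Unitriangularity: the topmost nonzero entry of a column is unaffected by the left action. -/
theorem entry_lsmul_of_leading (a : Uni F n) {f : Module.Dual F (nilp F P)} {j k : Fin n}
    (h : (j, k) ∈ P) (hf : ∀ i < j, entry f i k = 0) :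
    entry ((a, (1 : Uni F n)) • f) j k = entry f j k := by
  rw [entry_lsmul a f h, Finset.sum_eq_single j]
  · rw [mat_apply_self, one_mul]
  · intro i _ hi
    rcases lt_or_gt_of_ne hi with h' | h'
    · rw [hf i h', mul_zero]
    · rw [mat_apply_of_lt _ h', zero_mul]
  · simp

theorem entry_rsmul_of_leading (b : Uni F n) {f : Module.Dual F (nilp F P)} {j k : Fin n}
    (h : (j, k) ∈ P) (hf : ∀ l > k, entry f j l = 0) :
    entry (((1 : Uni F n), b) • f) j k = entry f j k := by
  rw [entry_rsmul b f h, Finset.sum_eq_single k]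
  · rw [mat_apply_self, mul_one]
  · intro l _ hl
    rcases lt_or_gt_of_ne hl with h' | h'
    · rw [mat_apply_of_lt _ h', mul_zero]
    · rw [hf l h', zero_mul]
  · simp

/-- If `f` and its right translate agree up to `coadj_P^R` on the support of `f`, then `f` is
supported on `coadj_P^R`. -/
theorem supp_subset_coadjR_of_rsmul {f : Module.Dual F (nilp F P)} {b : Uni F n}
    (h : ∀ j k, (j, k) ∈ supp f → (j, k) ∉ coadjR P m →
      entry (((1 : Uni F n), b) • f) j k = 0) : supp f ⊆ coadjR P m := by
  rintro ⟨j, k⟩ hjk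
  -- Along a row from right to left: `coadjR P m` is closed under moving left inside `P`, so a
  -- support position outside it has only zeros to its right, and its entry survives the translation
  -- unchanged.
  induction k using WellFoundedGT.induction with
  | ind k ih =>
    by_contra hR
    refine (mem_supp_iff f j k).1 hjk ?_
    rw [← entry_rsmul_of_leading b hjk.1, h j k hjk hR]
    intro l hl
    by_contra h0
    obtain ⟨-, l', h1, h2⟩ := ih l hl ((mem_supp_iff f j l).2 h0)
    exact hR ⟨hjk.1, l', h1, hP.out.mem_of_le (le_of_lt hl) le_rfl h2⟩

theorem supp_subset_coadjL_of_lsmul {f : Module.Dual F (nilp F P)} {a : Uni F n}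
    (h : ∀ j k, (j, k) ∈ supp f → (j, k) ∉ coadjL P m →
      entry ((a, (1 : Uni F n)) • f) j k = 0) : supp f ⊆ coadjL P m := by
  rintro ⟨j, k⟩ hjk
  induction j using WellFoundedLT.induction with
  | ind j ih =>
    by_contra hL
    refine (mem_supp_iff f j k).1 hjk ?_
    rw [← entry_lsmul_of_leading a hjk.1, h j k hjk hL]
    intro i hi
    by_contra h0
    obtain ⟨-, i', h1, h2⟩ := ih i hi ((mem_supp_iff f i k).2 h0)
    exact hL ⟨hjk.1, i', h1, hP.out.mem_of_le le_rfl (le_of_lt hi) h2⟩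

/-- Write `ca = a(a⁻¹ca)`. By normality the conjugate lies in `U_P`, so it moves `m` within `coadjL
P m`, a direction that `a` preserves. -/
theorem exists_lsmul_of_mem_subU (hm : m ∈ labeledSetPartitions F P) {c : Uni F n}
    (hc : c ∈ subU F P) {a : Uni F n} {α : Module.Dual F (nilp F P)}
    (ha : (a, (1 : Uni F n)) • m = m + α) :
    ∃ s, supp s ⊆ coadjL P m ∧ (c * a, (1 : Uni F n)) • m = m + α + s := by
  have h : ((a⁻¹ * c * a, (1 : Uni F n)) • m) ∈ lOrbit (subU F P) m :=
    ⟨_, by simpa using subU_normal.conj_mem c hc a⁻¹, rfl⟩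
  rw [mem_lOrbit_iff hm] at h
  refine ⟨_, supp_lsmul_subset_coadjL h a, ?_⟩
  rw [smul_dual_sub, smul_smul, ← ha]
  simp [mul_assoc]

theorem exists_rsmul_of_mem_subU (hm : m ∈ labeledSetPartitions F P) {c : Uni F n}
    (hc : c ∈ subU F P) {b : Uni F n} {β : Module.Dual F (nilp F P)}
    (hb : ((1 : Uni F n), b) • m = m + β) :
    ∃ r, supp r ⊆ coadjR P m ∧ ((1 : Uni F n), c * b) • m = m + β + r := by
  have h : (((1 : Uni F n), b⁻¹ * c * b) • m) ∈ rOrbit (subU F P) m :=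
    ⟨_, by simpa using subU_normal.conj_mem c hc b⁻¹, rfl⟩
  rw [mem_rOrbit_iff hm] at h
  refine ⟨_, supp_rsmul_subset_coadjR h b, ?_⟩
  rw [smul_dual_sub, smul_smul, ← hb]
  simp [mul_assoc]

/-- Two points `aλb` and `a'λb'` with reduced parameters in one two-sided `U_P`-orbit have the
same parameters. -/
theorem eq_of_mem_biOrbit (hm : m ∈ labeledSetPartitions F P) {a b a' b' : Uni F n}
    {α β α' β' : Module.Dual F (nilp F P)}
    (ha : (a, (1 : Uni F n)) • m = m + α) (hb : ((1 : Uni F n), b) • m = m + β)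
    (ha' : (a', (1 : Uni F n)) • m = m + α') (hb' : ((1 : Uni F n), b') • m = m + β')
    (hα : ∀ i j, (i, j) ∈ coadj P m → entry α i j = 0)
    (hα' : ∀ i j, (i, j) ∈ coadj P m → entry α' i j = 0)
    (hβ : ∀ i j, (i, j) ∈ coadjL (fullPoset n) m ∪ coadjR P m → entry β i j = 0)
    (hβ' : ∀ i j, (i, j) ∈ coadjL (fullPoset n) m ∪ coadjR P m → entry β' i j = 0)
    (h : (a, b) • m ∈ biOrbit (subU F P) ((a', b') • m)) : α = α' ∧ β = β' := by
  obtain ⟨c, hc, d, hd, h⟩ := h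
  obtain ⟨r, hr, hr'⟩ := exists_rsmul_of_mem_subU hm hd hb'
  obtain ⟨s, hs, hs'⟩ := exists_lsmul_of_mem_subU hm (inv_mem hc) ha
  -- Separating left and right factors in `h` shows that `w` is at once a left and a right translate
  -- of `m`. Its difference `f` from `m` compares `α` with `α'` after applying `a'`, and `β` with
  -- `β'` after applying `b`.
  set w := ((a'⁻¹ * (c⁻¹ * a), (1 : Uni F n))) • m with hw
  have hw' : w = ((1 : Uni F n), b⁻¹ * (d * b')) • m := by
    have e1 : w = (a'⁻¹ * c⁻¹, b⁻¹) • ((a, b) • m) := by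
      rw [hw, smul_smul]
      simp [mul_assoc]
    rw [e1, h, smul_smul, smul_smul]
    simp [mul_assoc]
  have hL : supp (w - m) ⊆ coadjL (fullPoset n) m :=
    (mem_lOrbit_iff hm _ w).1 ⟨_, by rw [subU_full]; trivial, hw⟩
  set f := w - m with hf
  have eR : ((1 : Uni F n), b) • f = β' - β + r := by
    rw [hf, smul_dual_sub, hb, hw', smul_smul, Prod.mk_mul_mk, one_mul, mul_inv_cancel_left, hr']
    abel
  have eL : (a', (1 : Uni F n)) • f = α - α' + s := by
    rw [hf, smul_dual_sub, ha', hw, smul_smul, Prod.mk_mul_mk, one_mul, mul_inv_cancel_left, hs']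
    abel
  rw [supp_subset_iff] at hr hs
  -- As `w` is a left translate, `f` lives on `coadjL (fullPoset n) m`, where `β` and `β'` vanish.
  -- The resulting bound by `coadjR P m` then puts `f` where `α` and `α'` vanish, which gives `hfL`.
  have hfR : supp f ⊆ coadjR P m := by
    refine supp_subset_coadjR_of_rsmul (b := b) fun j k h1 h2 => ?_
    rw [eR, entry_add, entry_sub, hβ' j k (Or.inl (hL h1)), hβ j k (Or.inl (hL h1)), hr j k h2]
    simp
  have hfL : supp f ⊆ coadjL P m := by
    refine supp_subset_coadjL_of_lsmul (a := a') fun j k h1 h2 => ?_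
    rw [eL, entry_add, entry_sub, hα j k (Or.inr (hfR h1)), hα' j k (Or.inr (hfR h1)),
      hs j k h2]
    simp
  -- Now `β' - β` is supported on `coadjR P m` and `α - α'` on `coadjL P m`, where all four
  -- functionals vanish.
  have h1 := (supp_subset_iff _ _).1 (supp_rsmul_subset_coadjR hfR b)
  have h2 := (supp_subset_iff _ _).1 (supp_lsmul_subset_coadjL hfL a')
  rw [eR] at h1
  rw [eL] at h2
  constructor
  · refine ext_entry fun i j _ => ?_
    by_cases hij : (i, j) ∈ coadjL P m
    · rw [hα i j (Or.inl hij), hα' i j (Or.inl hij)]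
    · have := h2 i j hij
      rwa [entry_add, entry_sub, hs i j hij, add_zero, sub_eq_zero] at this
  · refine ext_entry fun i j _ => ?_
    by_cases hij : (i, j) ∈ coadjR P m
    · rw [hβ i j (Or.inr hij), hβ' i j (Or.inr hij)]
    · have := h1 i j hij
      rw [entry_add, entry_sub, hr i j hij, add_zero, sub_eq_zero] at this
      exact this.symm

end Orbits

/-! ### Restriction to `U_P` and the representatives `μ + ℜ^*_μ(η)` -/

section Restriction

variable {F : Type*} [Field F] {n : ℕ} {P : PosetOn n}

theorem entry_restrictDual (lam : Module.Dual F (nilp F (fullPoset n))) {i j : Fin n}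
    (h : (i, j) ∈ P) : entry (restrictDual P lam) i j = entry lam i j := by
  rw [entry_of_mem _ h, entry_of_mem _ (P.mem_fullPoset h)]
  rfl

theorem supp_restrictDual_subset (lam : Module.Dual F (nilp F (fullPoset n))) :
    supp (restrictDual P lam) ⊆ supp lam := by
  rintro ⟨i, j⟩ h
  exact ⟨P.mem_fullPoset h.1, by simpa [entry_restrictDual lam h.1] using h.2⟩

theorem restrictDual_mem_labeledSetPartitions {lam : Module.Dual F (nilp F (fullPoset n))}
    (h : lam ∈ labeledSetPartitions F (fullPoset n)) :
    restrictDual P lam ∈ labeledSetPartitions F P :=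
  ⟨fun i j j' h1 h2 => h.1 i j j' (supp_restrictDual_subset lam h1)
      (supp_restrictDual_subset lam h2),
    fun i i' j h1 h2 => h.2 i i' j (supp_restrictDual_subset lam h1)
      (supp_restrictDual_subset lam h2)⟩

theorem coadj_subset_coadj_full (m : Module.Dual F (nilp F P)) :
    coadj P m ⊆ coadj (fullPoset n) m := by
  rintro ⟨i, j⟩ (⟨h, k, h1, h2⟩ | ⟨h, k, h1, h2⟩)
  · exact Or.inl ⟨h, k, h1, P.mem_fullPoset h2⟩
  · exact Or.inr ⟨h, k, h1, P.mem_fullPoset h2⟩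

theorem ncard_coaux_add (m : Module.Dual F (nilp F P)) :
    (coaux P m).ncard + (coadj P m).ncard = (coadj (fullPoset n) m).ncard :=
  Set.ncard_sdiff_add_ncard_of_subset (coadj_subset_coadj_full m)

theorem coaux_subset (m : Module.Dual F (nilp F P)) : coaux P m ⊆ coauxL P m ∪ coauxR P m := by
  rintro p ⟨h1 | h1, h2⟩
  · exact Or.inl ⟨h1, fun h => h2 (Or.inl h)⟩
  · exact Or.inr ⟨h1, fun h => h2 (Or.inr h)⟩

variable {m eta : Module.Dual F (nilp F P)}

theorem entry_part_left_eq_zero (heta : supp eta ⊆ coaux P m) :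
    ∀ i j, (i, j) ∈ coadj P m → entry (part (coauxL P m) eta) i j = 0 := by
  classical
  intro i j h
  rw [entry_part, (supp_subset_iff _ _).1 heta i j fun h' => h'.2 h, ite_self]

/-- A position of `coaux P m` inside `coadjL (fullPoset n) m` belongs to `coauxL P m`, which this
part omits. Hence the asymmetric splitting of `η`: it supplies the vanishing that
`eq_of_mem_biOrbit` needs. -/
theorem entry_part_right_eq_zero (heta : supp eta ⊆ coaux P m) :
    ∀ i j, (i, j) ∈ coadjL (fullPoset n) m ∪ coadjR P m →
      entry (part (coauxR P m \ coauxL P m) eta) i j = 0 := by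
  classical
  intro i j h
  rw [entry_part]
  split_ifs with h'
  · refine (supp_subset_iff _ _).1 heta i j fun h2 => ?_
    rcases h with h | h
    · exact h'.2 ⟨h, fun h3 => h2.2 (Or.inl h3)⟩
    · exact h'.1.2 h
  · rfl

theorem supp_part_subset (S : Set (Fin n × Fin n)) (f : Module.Dual F (nilp F P)) :
    supp (part S f) ⊆ S := by
  classical
  rw [supp_subset_iff]
  intro i j h
  rw [entry_part, if_neg h]

theorem eq_of_part_eq {eta' : Module.Dual F (nilp F P)} (heta : supp eta ⊆ coaux P m)
    (heta' : supp eta' ⊆ coaux P m) (hL : part (coauxL P m) eta = part (coauxL P m) eta')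
    (hR : part (coauxR P m \ coauxL P m) eta = part (coauxR P m \ coauxL P m) eta') :
    eta = eta' := by
  classical
  refine ext_entry fun i j _ => ?_
  by_cases h : (i, j) ∈ coaux P m
  · by_cases h1 : (i, j) ∈ coauxL P m
    · simpa [entry_part, h1] using congrArg (fun f => entry f i j) hL
    · have h2 : (i, j) ∈ coauxR P m := (coaux_subset m h).resolve_left h1
      simpa [entry_part, h1, h2] using congrArg (fun f => entry f i j) hR
  · rw [(supp_subset_iff _ _).1 heta i j h, (supp_subset_iff _ _).1 heta' i j h]

variable [Finite F] [hP : Fact P.IsNormal]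

theorem exists_smul_eq_add_part (hm : m ∈ labeledSetPartitions F P)
    (eta : Module.Dual F (nilp F P)) :
    ∃ a b : Uni F n, (a, (1 : Uni F n)) • m = m + part (coauxL P m) eta ∧
      ((1 : Uni F n), b) • m = m + part (coauxR P m \ coauxL P m) eta ∧
      (a, b) • m = m + repMap m eta := by
  have h1 : m + part (coauxL P m) eta ∈ lOrbit (subU F (fullPoset n)) m := by
    rw [mem_lOrbit_iff hm, add_sub_cancel_left]
    exact (supp_part_subset _ _).trans Set.sdiff_subset
  have h2 : m + part (coauxR P m \ coauxL P m) eta ∈ rOrbit (subU F (fullPoset n)) m := by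
    rw [mem_rOrbit_iff hm, add_sub_cancel_left]
    exact (supp_part_subset _ _).trans (Set.sdiff_subset.trans Set.sdiff_subset)
  obtain ⟨a, -, ha⟩ := h1
  obtain ⟨b, -, hb⟩ := h2
  exact ⟨a, b, ha.symm, hb.symm, smul_eq_add_starProd hm ha.symm hb.symm⟩

/-- The two-sided `U_P`-orbits of the representatives `λ + ℜ^*_λ(η)` partition the two-sided
`U_n`-orbit of `λ`. -/
theorem finsum_repMap (hm : m ∈ labeledSetPartitions F P) (T : Module.Dual F (nilp F P) → ℂ) :
    ∑ᶠ eta ∈ {eta : Module.Dual F (nilp F P) | supp eta ⊆ coaux P m},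
        ∑ᶠ u ∈ biOrbit (subU F P) (m + repMap m eta), T u
      = ∑ᶠ u ∈ biOrbit (⊤ : Subgroup (Uni F n)) m, T u := by
  refine finsum_biOrbit_eq_sum _ m _ (Set.toFinite _) _ ?_ ?_ ?_ T
  · intro eta _
    obtain ⟨a, b, -, -, h⟩ := exists_smul_eq_add_part hm eta
    exact ⟨a, trivial, b, trivial, h.symm⟩
  · intro eta heta eta' heta' h
    obtain ⟨a, b, h1, h2, h3⟩ := exists_smul_eq_add_part hm eta
    obtain ⟨a', b', h1', h2', h3'⟩ := exists_smul_eq_add_part hm eta'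
    rw [← h3, ← h3'] at h
    obtain ⟨e1, e2⟩ := eq_of_mem_biOrbit hm h1 h2 h1' h2' (entry_part_left_eq_zero heta)
      (entry_part_left_eq_zero heta') (entry_part_right_eq_zero heta)
      (entry_part_right_eq_zero heta') h
    exact eq_of_part_eq heta heta' e1 e2
  -- Both orbit sizes are powers of `q`, with `U_n` treated as the pattern group of `fullPoset n`;
  -- the exponents differ by `|coaux P m|`.
  · rw [← subU_full, ncard_biOrbit hm, ncard_biOrbit hm,
      ncard_supp_subset (fun p hp => hp.1.elim And.left And.left), ← pow_add, ncard_coaux_add]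

theorem supercharacterPair_eq (θ : AddChar F ℂ) (hm : m ∈ labeledSetPartitions F P)
    (eta : Module.Dual F (nilp F P)) (g : patternGroup F P) :
    supercharacterPair θ m eta g
      = ((Nat.card F : ℂ) ^ (coadjL P m).ncard / (Nat.card F : ℂ) ^ (coadj P m).ncard) *
        ∑ᶠ u ∈ biOrbit (subU F P) (m + repMap m eta), θ (u (subOne g)) := by
  obtain ⟨a, b, -, -, h⟩ := exists_smul_eq_add_part hm eta
  rw [supercharacterPair, supercharacter, leftOrbit_eq_lOrbit, twoSidedOrbit_eq_biOrbit, ← h,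
    ncard_lOrbit_smul, ncard_biOrbit_smul, ncard_lOrbit hm, ncard_biOrbit hm]
  push_cast
  rfl

theorem resU_supercharacter_eq (θ : AddChar F ℂ) {lam : Module.Dual F (nilp F (fullPoset n))}
    (hlam : lam ∈ labeledSetPartitions F (fullPoset n)) (g : patternGroup F P) :
    resU P (supercharacter θ lam) g
      = (Nat.card F : ℂ) ^ (coadjL (fullPoset n) lam).ncard /
          (Nat.card F : ℂ) ^ (coadj (fullPoset n) (restrictDual P lam)).ncard *
        ∑ᶠ u ∈ biOrbit (⊤ : Subgroup (Uni F n)) (restrictDual P lam), θ (u (subOne g)) := by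
  have h := finsum_biOrbit_map (restrictDual P) restrictDual_smul (subU F (fullPoset n)) lam
    fun u => θ (u (subOne g))
  have e : ((biOrbit (subU F (fullPoset n)) (restrictDual P lam)).ncard : ℂ)
      = (Nat.card F : ℂ) ^ (coadj (fullPoset n) (restrictDual P lam)).ncard := by
    rw [ncard_biOrbit (restrictDual_mem_labeledSetPartitions hlam)]
    push_cast
    rfl
  rw [e] at h
  rw [resU, supercharacter, leftOrbit_eq_lOrbit, twoSidedOrbit_eq_biOrbit, div_mul_eq_mul_div,
    mul_div_assoc]
  -- A functional on `𝔫_n` and its restriction agree on `g - 1` by definition.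
  refine (congrArg _ h).trans ?_
  rw [ncard_lOrbit hlam, subU_full]
  push_cast
  ring

end Restriction

end PatternGroup

/-! ### The restriction formula -/

theorem mainTheorem6 {F : Type*} [Field F] [Finite F] (θ : AddChar F ℂ) (hθ : θ ≠ 1)
    {n : ℕ} (P : PatternGroup.PosetOn n) (hP : P.IsNormal)
    (lam : Module.Dual F (PatternGroup.nilp F (PatternGroup.fullPoset n)))
    (hlam : lam ∈ PatternGroup.labeledSetPartitions F (PatternGroup.fullPoset n))
    (mu : Module.Dual F (PatternGroup.nilp F P))
    (hmu : mu = PatternGroup.restrictDual P lam)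
    (c : ℤ)
    (hc : c = ((PatternGroup.coadjL (PatternGroup.fullPoset n) lam).ncard : ℤ)
      - ((PatternGroup.coadjL P mu).ncard : ℤ) - ((PatternGroup.coaux P mu).ncard : ℤ)) :
    mu ∈ PatternGroup.labeledSetPartitions F P ∧
    PatternGroup.resU P (PatternGroup.supercharacter θ lam) =
      fun g => (Nat.card F : ℂ) ^ c *
        ∑ᶠ eta ∈ {eta : Module.Dual F (PatternGroup.nilp F P) |
            PatternGroup.supp eta ⊆ PatternGroup.coaux P mu},
          PatternGroup.supercharacterPair θ mu eta g := by
  have : Fact P.IsNormal := ⟨hP⟩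
  subst hmu
  have hm := PatternGroup.restrictDual_mem_labeledSetPartitions (P := P) hlam
  refine ⟨hm, funext fun g => ?_⟩
  have hq : (Nat.card F : ℂ) ≠ 0 := by exact_mod_cast Nat.card_pos.ne'
  rw [PatternGroup.resU_supercharacter_eq θ hlam,
    finsum_mem_congr rfl fun eta _ => PatternGroup.supercharacterPair_eq θ hm eta g,
    ← mul_finsum_mem, PatternGroup.finsum_repMap hm, ← mul_assoc]
  congr 1
  -- Both sides are now multiples of one sum over `U_n μ U_n`; the powers of `q` agree because
  -- `|coadj_{[[n]]}(μ)| = |coaux_P(μ)| + |coadj_P(μ)|`.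
  rw [hc, ← PatternGroup.ncard_coaux_add, zpow_sub₀ hq, zpow_sub₀ hq, pow_add]
  simp only [zpow_natCast]
  field_simp
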